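/- Let $F$ be a field of characteristic different from $2$, and let $A$ be a Novikov algebra over $F$, that is, a (not necessarily associative or unital) $F$-algebra satisfying $(x,y,z)=(y,x,z)$ and $(xy)z=(xz)y$ for all $x,y,z\in A$, where $(x,y,z)=(xy)z-x(yz)$. Put $A^{(0)_L}=A$ and let $A^{(n+1)_L}$ be the linear span of all commutators $uv-vu$ with $u,v\in A^{(n)_L}$; assume that $A$ is Lie-solvable, i.e. $A^{(n)_L}=0$ for some $n\ge 0$. Call an algebra $B$ left-quasiregular if for every $x\in B$ there is $y\in B$ with $x+y=yx$. Let $\mathcal C$ be the class of all Novikov $F$-algebras whose heart $H$ (the intersection of all nonzero two-sided ideals) is nonzero and idempotent ($H^2=H$, where $H^2$ is the span of all products of two elements of $H$); let $\mathcal A$ be the class of all Novikov $F$-algebras that have no homomorphism onto an algebra in $\mathcal C$. The Andrunakievich radical $\mathcal A(A)$ is the largest two-sided ideal of $A$ that, as an algebra, belongs to $\mathcal A$. If $I$ is a two-sided ideal of $A$ such that the algebras $I$ and $A/I$ are left-quasiregular, then $A$ is left-quasiregular. Moreover, $A=\mathcal A(A)$. -/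

import Mathlib

universe u

/-- The identities of a Novikov algebra: the associator is symmetric in its first two arguments,
and right multiplications commute. -/
structure IsNovikov (A : Type*) [NonUnitalNonAssocRing A] : Prop where
  associator_symm : ∀ x y z : A, associator x y z = associator y x z
  right_comm : ∀ x y z : A, (x * y) * z = (x * z) * y

/-- An algebra is left-quasiregular if every `x` has a `y` in the algebra with `x + y = yx`. -/
def IsLeftQuasiregular (A : Type*) [NonUnitalNonAssocRing A] : Prop :=
  ∀ x : A, ∃ y : A, x + y = y * x

/-- Two-sided ideals of a (nonassociative, nonunital) algebra `A` over `F`. -/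
structure AlgIdeal (F A : Type*) [Field F] [NonUnitalNonAssocRing A] [Module F A] extends
    Submodule F A where
  mul_mem_left' : ∀ a x : A, x ∈ carrier → a * x ∈ carrier
  mul_mem_right' : ∀ x a : A, x ∈ carrier → x * a ∈ carrier

namespace AlgIdeal

section Basic

variable {F A : Type*} [Field F] [NonUnitalNonAssocRing A] [Module F A]

instance : SetLike (AlgIdeal F A) A where
  coe I := I.carrier
  coe_injective I J h := by
    cases I; cases J; congr 1; exact SetLike.coe_injective h

instance : PartialOrder (AlgIdeal F A) := PartialOrder.ofSetLike (AlgIdeal F A) A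

instance : NonUnitalSubringClass (AlgIdeal F A) A where
  add_mem {I} _ _ ha hb := I.toSubmodule.add_mem ha hb
  zero_mem I := I.toSubmodule.zero_mem
  neg_mem {I} _ ha := I.toSubmodule.neg_mem ha
  mul_mem {I} a b _ hb := I.mul_mem_left' a b hb

instance : SMulMemClass (AlgIdeal F A) F A where
  smul_mem {I} r _ hx := I.toSubmodule.smul_mem r hx

/-- The whole algebra, as an ideal. -/
instance : Top (AlgIdeal F A) where
  top := { (⊤ : Submodule F A) with
    mul_mem_left' := fun _ _ _ => trivial
    mul_mem_right' := fun _ _ _ => trivial }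

/-- The underlying space of the quotient algebra `A / I`. -/
def QuotAlg (I : AlgIdeal F A) : Type _ := A ⧸ I.toSubmodule

instance (I : AlgIdeal F A) : AddCommGroup I.QuotAlg :=
  inferInstanceAs (AddCommGroup (A ⧸ I.toSubmodule))

instance (I : AlgIdeal F A) : Module F I.QuotAlg :=
  inferInstanceAs (Module F (A ⧸ I.toSubmodule))

/-- The class of an element in the quotient algebra. -/
def proj (I : AlgIdeal F A) : A →ₗ[F] I.QuotAlg := I.toSubmodule.mkQ

theorem proj_surjective (I : AlgIdeal F A) : Function.Surjective I.proj :=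
  I.toSubmodule.mkQ_surjective

theorem proj_eq_proj (I : AlgIdeal F A) {a b : A} : I.proj a = I.proj b ↔ a - b ∈ I :=
  Submodule.Quotient.eq I.toSubmodule

/-- The product of the classes of `a` and `b` is the class of `a * b`. -/
instance (I : AlgIdeal F A) : Mul I.QuotAlg where
  mul := Quotient.map₂ (· * ·) (by
    intro a a' ha b b' hb
    have ha' : a - a' ∈ I := (Submodule.quotientRel_def _).1 ha
    have hb' : b - b' ∈ I := (Submodule.quotientRel_def _).1 hb
    refine (Submodule.quotientRel_def _).2 ?_
    have h : a * b - a' * b' = (a - a') * b + a' * (b - b') := by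
      rw [sub_mul, mul_sub]; abel
    change a * b - a' * b' ∈ I
    rw [h]
    exact add_mem (I.mul_mem_right' _ _ ha') (I.mul_mem_left' _ _ hb'))

theorem proj_mul (I : AlgIdeal F A) (a b : A) : I.proj (a * b) = I.proj a * I.proj b := rfl

/-- The quotient algebra `A / I`. -/
instance (I : AlgIdeal F A) : NonUnitalNonAssocRing I.QuotAlg where
  left_distrib x y z := by
    obtain ⟨a, rfl⟩ := I.proj_surjective x
    obtain ⟨b, rfl⟩ := I.proj_surjective y
    obtain ⟨c, rfl⟩ := I.proj_surjective z
    rw [← map_add, ← proj_mul, mul_add, map_add, proj_mul, proj_mul]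
  right_distrib x y z := by
    obtain ⟨a, rfl⟩ := I.proj_surjective x
    obtain ⟨b, rfl⟩ := I.proj_surjective y
    obtain ⟨c, rfl⟩ := I.proj_surjective z
    rw [← map_add, ← proj_mul, add_mul, map_add, proj_mul, proj_mul]
  zero_mul x := by
    obtain ⟨a, rfl⟩ := I.proj_surjective x
    rw [← map_zero I.proj, ← proj_mul, zero_mul]
  mul_zero x := by
    obtain ⟨a, rfl⟩ := I.proj_surjective x
    rw [← map_zero I.proj, ← proj_mul, mul_zero]

instance [IsScalarTower F A A] (I : AlgIdeal F A) : IsScalarTower F I.QuotAlg I.QuotAlg where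
  smul_assoc r x y := by
    obtain ⟨a, rfl⟩ := I.proj_surjective x
    obtain ⟨b, rfl⟩ := I.proj_surjective y
    rw [smul_eq_mul, smul_eq_mul, ← map_smul, ← proj_mul, ← proj_mul, smul_mul_assoc, map_smul]

instance [SMulCommClass F A A] (I : AlgIdeal F A) : SMulCommClass F I.QuotAlg I.QuotAlg where
  smul_comm r x y := by
    obtain ⟨a, rfl⟩ := I.proj_surjective x
    obtain ⟨b, rfl⟩ := I.proj_surjective y
    rw [smul_eq_mul, smul_eq_mul, ← map_smul, ← proj_mul, ← proj_mul, mul_smul_comm, map_smul]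

end Basic

end AlgIdeal

section Notions

variable (F A : Type*) [Field F] [NonUnitalNonAssocRing A] [Module F A]

/-- The Lie-solvable powers: the zeroth is `A`, and the `(n+1)`-st is the subspace spanned by the
commutators of elements of the `n`-th. -/
def lieSolvablePower : ℕ → Submodule F A
  | 0 => ⊤
  | n + 1 => Submodule.span F
      {z | ∃ x ∈ lieSolvablePower n, ∃ y ∈ lieSolvablePower n, z = x * y - y * x}

/-- `A` is Lie-solvable if some Lie-solvable power of it vanishes. -/
def IsLieSolvable : Prop := ∃ n : ℕ, lieSolvablePower F A n = ⊥

/-- The heart: the intersection of all nonzero ideals. -/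
def heart : Submodule F A :=
  sInf {M | ∃ I : AlgIdeal F A, I.toSubmodule = M ∧ M ≠ ⊥}

/-- `A` is subdirectly irreducible: the intersection of all its nonzero ideals is nonzero. (The
zero algebra has no nonzero ideals; its heart is the zero space, so it is excluded.) -/
def IsSubdirectlyIrreducible : Prop := heart F A ≠ ⊥

/-- The heart `H` is idempotent: `H` is spanned by the products of its elements. -/
def HasIdempotentHeart : Prop :=
  Submodule.span F {z | ∃ x ∈ heart F A, ∃ y ∈ heart F A, z = x * y} = heart F A

/-- `A` is a subdirectly irreducible Novikov algebra with idempotent heart. -/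
def IsNovikovSIWithIdempotentHeart : Prop :=
  IsNovikov A ∧ IsSubdirectlyIrreducible F A ∧ HasIdempotentHeart F A

end Notions

/-- The Andrunakievich radical class: Novikov algebras with no homomorphism onto a subdirectly
irreducible Novikov algebra with idempotent heart. (A homomorphic image of `A` has an isomorphic
copy in the universe of `A`.) -/
def IsAndrunakievich (F : Type*) (A : Type u) [Field F] [NonUnitalNonAssocRing A] [Module F A] :
    Prop :=
  IsNovikov A ∧
    ∀ (B : Type u) [NonUnitalNonAssocRing B] [Module F B] [IsScalarTower F B B]
      [SMulCommClass F B B] (f : A →ₙₐ[F] B),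
      Function.Surjective f → ¬ IsNovikovSIWithIdempotentHeart F B

/-- `R` is the Andrunakievich radical of `A`: the largest ideal of `A` that, as an algebra, belongs
to the Andrunakievich radical class. -/
def IsAndrunakievichRadical {F A : Type*} [Field F] [NonUnitalNonAssocRing A] [Module F A]
    (R : AlgIdeal F A) : Prop :=
  IsGreatest {J : AlgIdeal F A | IsAndrunakievich F J} R

/-! ### Identities of Novikov algebras -/

section NovikovIdentities

variable {A : Type*} [NonUnitalNonAssocRing A]

/-! Right multiplications `R a` commute, and left symmetry says `[L l, R c] = R (l * c) - R l * R
c`; write `S(l, c)` for this defect of multiplicativity. Each `L l` thus acts as a derivation on the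
commutative ring generated by the `R a`. Differentiating `S(k * b, a) = R b * S(k, a)` expresses `2
* S(k, a) ^ 2` through `R` of commutators (`two_mul_sq`). Descending the Lie-solvable powers from
zero, this makes every `S(a, b)` nilpotent, so `R` is multiplicative modulo nilpotents. Left
quasiregularity then amounts to invertibility of `1 - R x`, which passes to extensions.

For the radical, suppose an image of `A` has a nonzero idempotent heart. Its last nonzero
Lie-solvable power is a commutative ideal containing the heart. The heart is therefore central and
associative, each nonzero element `h` has some `e` in the heart with `h * e = h`, and
quasiregularity of `e` forces `h = 0`. -/

theorem IsNovikov.mul_mul_sub (hA : IsNovikov A) (x y z : A) :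
    (x * y) * z - x * (y * z) = (y * x) * z - y * (x * z) :=
  hA.associator_symm x y z

/-- After left symmetry moves `a` to the front of every term, right commutativity lets `b` pass to
the far right. -/
theorem IsNovikov.associator_mul (hA : IsNovikov A) (x a b c : A) :
    (x * (a * b)) * c - x * ((a * b) * c) = ((x * a) * c - x * (a * c)) * b := by
  rw [hA.mul_mul_sub x (a * b) c, hA.mul_mul_sub x a c, sub_mul, hA.right_comm a b x,
    hA.right_comm (a * x) b c, hA.right_comm a b (x * c)]

theorem IsNovikov.two_commutator_mul (hA : IsNovikov A) (a b c : A) :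
    2 • ((a * b - b * a) * c) = ((a * c) * b - b * (a * c)) - ((b * c) * a - a * (b * c)) := by
  have h := hA.mul_mul_sub a b c
  rw [hA.right_comm a c b, hA.right_comm b c a, sub_mul, two_nsmul]
  have h' : a * (b * c) = (a * b) * c - (b * a) * c + b * (a * c) := by
    rw [← sub_eq_zero] at h ⊢; rw [← neg_eq_zero, ← h]; abel
  rw [h']
  abel

/-- This is the Jacobi identity: left-symmetric algebras are Lie-admissible. -/
theorem IsNovikov.commutator_leibniz (hA : IsNovikov A) (c a b : A) :
    c * (a * b - b * a) = ((c * a - a * c) * b - b * (c * a - a * c)) +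
      (a * (c * b - b * c) - (c * b - b * c) * a) + (a * b - b * a) * c := by
  have h1 := hA.mul_mul_sub c a b
  have h2 := hA.mul_mul_sub c b a
  have h3 := hA.mul_mul_sub a b c
  rw [mul_sub, mul_sub, mul_sub, sub_mul, sub_mul, sub_mul]
  have e1 : c * (a * b) = (c * a) * b - (a * c) * b + a * (c * b) := by
    rw [← sub_eq_zero] at h1 ⊢; rw [← neg_eq_zero, ← h1]; abel
  have e2 : c * (b * a) = (c * b) * a - (b * c) * a + b * (c * a) := by
    rw [← sub_eq_zero] at h2 ⊢; rw [← neg_eq_zero, ← h2]; abel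
  have e3 : a * (b * c) = (a * b) * c - (b * a) * c + b * (a * c) := by
    rw [← sub_eq_zero] at h3 ⊢; rw [← neg_eq_zero, ← h3]; abel
  rw [e1, e2, e3]
  abel

end NovikovIdentities

/-! ### Lie-solvable powers are ideals -/

section LieSolvablePower

variable {F A : Type*} [Field F] [NonUnitalNonAssocRing A] [Module F A]

theorem commutator_mem_lieSolvablePower_succ {n : ℕ} {x y : A}
    (hx : x ∈ lieSolvablePower F A n) (hy : y ∈ lieSolvablePower F A n) :
    x * y - y * x ∈ lieSolvablePower F A (n + 1) :=
  Submodule.subset_span ⟨x, hx, y, hy, rfl⟩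

theorem lieSolvablePower_succ_le_one (n : ℕ) :
    lieSolvablePower F A (n + 1) ≤ lieSolvablePower F A 1 := by
  refine Submodule.span_mono ?_
  rintro _ ⟨x, -, y, -, rfl⟩
  exact ⟨x, trivial, y, trivial, rfl⟩

variable [IsScalarTower F A A] [SMulCommClass F A A]

theorem lieSolvablePower_mul_mem (hF : (2 : F) ≠ 0) (hA : IsNovikov A) (n : ℕ) :
    ∀ x ∈ lieSolvablePower F A n, ∀ c : A,
      x * c ∈ lieSolvablePower F A n ∧ c * x ∈ lieSolvablePower F A n := by
  induction n with
  | zero => exact fun _ _ _ => ⟨trivial, trivial⟩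
  | succ n ih =>
    intro x hx c
    have hright : ∀ a ∈ lieSolvablePower F A n, ∀ b ∈ lieSolvablePower F A n,
        (a * b - b * a) * c ∈ lieSolvablePower F A (n + 1) := by
      intro a ha b hb
      have h := hA.two_commutator_mul a b c
      have hmem : (2 : F) • ((a * b - b * a) * c) ∈ lieSolvablePower F A (n + 1) := by
        rw [ofNat_smul_eq_nsmul, h]
        exact sub_mem (commutator_mem_lieSolvablePower_succ (ih a ha c).1 hb)
          (commutator_mem_lieSolvablePower_succ (ih b hb c).1 ha)
      exact (Submodule.smul_mem_iff _ hF).1 hmem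
    refine Submodule.span_induction (p := fun x _ => x * c ∈ lieSolvablePower F A (n + 1) ∧
      c * x ∈ lieSolvablePower F A (n + 1)) ?_ ?_ ?_ ?_ hx
    · rintro _ ⟨a, ha, b, hb, rfl⟩
      refine ⟨hright a ha b hb, ?_⟩
      rw [hA.commutator_leibniz c a b]
      have hca := sub_mem (ih a ha c).2 (ih a ha c).1
      have hcb := sub_mem (ih b hb c).2 (ih b hb c).1
      exact add_mem (add_mem (commutator_mem_lieSolvablePower_succ hca hb)
        (commutator_mem_lieSolvablePower_succ ha hcb)) (hright a ha b hb)
    · simp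
    · intro x y _ _ hx hy
      rw [add_mul, mul_add]
      exact ⟨add_mem hx.1 hy.1, add_mem hx.2 hy.2⟩
    · intro r x _ hx
      rw [smul_mul_assoc, mul_smul_comm]
      exact ⟨Submodule.smul_mem _ r hx.1, Submodule.smul_mem _ r hx.2⟩

end LieSolvablePower

/-! ### Nilpotence of the multiplicativity defect -/

section RightMultiplications

variable {F A T : Type*} [Field F] [NonUnitalNonAssocRing A] [Module F A] [CommRing T] [Algebra F T]

/-- The identities that hold between the right multiplications of a Novikov algebra, in the
commutative ring which they generate. The second one is the action of a left multiplication, as a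
derivation, on the first one. -/
structure IsRightMultiplicationMap (ρ : A →ₗ[F] T) : Prop where
  map_mul_mul : ∀ a b c : A,
    ρ ((a * b) * c) - ρ (a * b) * ρ c = ρ b * (ρ (a * c) - ρ a * ρ c)
  derivation : ∀ l k b a : A,
    (ρ (l * ((k * b) * a)) - ρ l * ρ ((k * b) * a)) - (ρ (l * (k * b)) - ρ l * ρ (k * b)) * ρ a
        - ρ (k * b) * (ρ (l * a) - ρ l * ρ a) =
      (ρ (l * b) - ρ l * ρ b) * (ρ (k * a) - ρ k * ρ a) +
        ρ b * ((ρ (l * (k * a)) - ρ l * ρ (k * a)) - (ρ (l * k) - ρ l * ρ k) * ρ a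
          - ρ k * (ρ (l * a) - ρ l * ρ a))

namespace IsRightMultiplicationMap

variable {ρ : A →ₗ[F] T}

/-- Take `l = k`, `b = a` in `derivation`. One square is explicit; the other comes from collecting
`ρ (k * a)` and `ρ a * ρ k` against `S(k, a)`. The instances of `map_mul_mul` complete the other
terms to commutators. -/
theorem two_mul_sq (hρ : IsRightMultiplicationMap ρ) (k a : A) :
    2 * (ρ (k * a) - ρ k * ρ a) ^ 2 =
      ρ (k * ((k * a) * a) - ((k * a) * a) * k) - 2 * ρ a * ρ (k * (k * a) - (k * a) * k) := by
  have h1 := hρ.map_mul_mul k a k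
  have h2 := hρ.map_mul_mul (k * a) a k
  have h4 := hρ.derivation k k a a
  rw [map_sub, map_sub]
  linear_combination (-1 : T) * h4 + h2 - ρ a * h1

theorem isNilpotent_sub (hF : (2 : F) ≠ 0) (hρ : IsRightMultiplicationMap ρ) {n : ℕ}
    (hideal : ∀ x ∈ lieSolvablePower F A n, ∀ c : A, x * c ∈ lieSolvablePower F A n)
    (hnil : ∀ v ∈ lieSolvablePower F A (n + 1), IsNilpotent (ρ v))
    {k : A} (hk : k ∈ lieSolvablePower F A n) (a : A) :
    IsNilpotent (ρ (k * a) - ρ k * ρ a) := by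
  have hka := hideal k hk a
  have h : IsNilpotent (2 * (ρ (k * a) - ρ k * ρ a) ^ 2) := by
    rw [hρ.two_mul_sq k a]
    exact (Commute.all _ _).isNilpotent_sub
      (hnil _ (commutator_mem_lieSolvablePower_succ hk (hideal _ hka a)))
      ((Commute.all _ _).isNilpotent_mul_left
        (hnil _ (commutator_mem_lieSolvablePower_succ hk hka)))
  have h2 : (ρ (k * a) - ρ k * ρ a) ^ 2 =
      algebraMap F T 2⁻¹ * (2 * (ρ (k * a) - ρ k * ρ a) ^ 2) := by
    have h3 : algebraMap F T 2⁻¹ * 2 = 1 := by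
      rw [← map_ofNat (algebraMap F T) 2, ← map_mul]
      exact (congrArg _ (inv_mul_cancel₀ hF)).trans (map_one _)
    rw [← mul_assoc, h3, one_mul]
  have h3 : IsNilpotent ((ρ (k * a) - ρ k * ρ a) ^ 2) := by
    rw [h2]
    exact (Commute.all _ _).isNilpotent_mul_left h
  exact IsNilpotent.of_pow h3

/-- Since `ρ k * S(b, c) = S(b * k, c)` is nilpotent, so is `ρ k * ρ v` for every `v` in the first
power; `v = k` is allowed. -/
theorem isNilpotent_of_mem_succ (hF : (2 : F) ≠ 0) (hρ : IsRightMultiplicationMap ρ)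
    (hideal : ∀ n, ∀ x ∈ lieSolvablePower F A n, ∀ c : A,
      x * c ∈ lieSolvablePower F A n ∧ c * x ∈ lieSolvablePower F A n) {n : ℕ}
    (hnil : ∀ v ∈ lieSolvablePower F A (n + 2), IsNilpotent (ρ v))
    {k : A} (hk : k ∈ lieSolvablePower F A (n + 1)) : IsNilpotent (ρ k) := by
  have hS : ∀ b c : A, IsNilpotent (ρ k * (ρ (b * c) - ρ b * ρ c)) := by
    intro b c
    rw [← hρ.map_mul_mul b k c]
    exact hρ.isNilpotent_sub hF (fun x hx c => (hideal _ x hx c).1) hnil (hideal _ k hk b).2 c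
  have hv : ∀ v ∈ lieSolvablePower F A 1, IsNilpotent (ρ k * ρ v) := by
    intro v hv
    refine Submodule.span_induction (p := fun v _ => IsNilpotent (ρ k * ρ v)) ?_ ?_ ?_ ?_ hv
    · rintro _ ⟨b, -, c, -, rfl⟩
      have h : ρ k * ρ (b * c - c * b) =
          ρ k * (ρ (b * c) - ρ b * ρ c) - ρ k * (ρ (c * b) - ρ c * ρ b) := by
        rw [map_sub]; ring
      rw [h]
      exact (Commute.all _ _).isNilpotent_sub (hS b c) (hS c b)
    · simp
    · intro x y _ _ hx hy
      rw [map_add, mul_add]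
      exact (Commute.all _ _).isNilpotent_add hx hy
    · intro r x _ hx
      rw [map_smul, mul_smul_comm]
      exact hx.smul r
  have h := hv k (lieSolvablePower_succ_le_one n hk)
  rw [← pow_two] at h
  exact IsNilpotent.of_pow h

theorem isNilpotent_of_mem_one (hF : (2 : F) ≠ 0) (hρ : IsRightMultiplicationMap ρ)
    (hideal : ∀ n, ∀ x ∈ lieSolvablePower F A n, ∀ c : A,
      x * c ∈ lieSolvablePower F A n ∧ c * x ∈ lieSolvablePower F A n)
    (hLie : IsLieSolvable F A) : ∀ v ∈ lieSolvablePower F A 1, IsNilpotent (ρ v) := by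
  obtain ⟨n, hn⟩ := hLie
  -- The index is raised by one so that the descent stops at the first power.
  have h0 : ∀ v ∈ lieSolvablePower F A (n + 1), IsNilpotent (ρ v) := by
    intro v hv
    have hle : lieSolvablePower F A (n + 1) ≤ ⊥ := by
      refine Submodule.span_le.2 ?_
      rintro _ ⟨x, hx, y, -, rfl⟩
      rw [hn, Submodule.mem_bot] at hx
      simp [hx]
    rw [(Submodule.mem_bot F).1 (hle hv), map_zero]
    exact IsNilpotent.zero
  clear hn
  induction n with
  | zero => exact h0
  | succ n ih => exact ih fun v hv => hρ.isNilpotent_of_mem_succ hF hideal h0 hv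

theorem isNilpotent_map_mul_sub (hF : (2 : F) ≠ 0) (hρ : IsRightMultiplicationMap ρ)
    (hideal : ∀ n, ∀ x ∈ lieSolvablePower F A n, ∀ c : A,
      x * c ∈ lieSolvablePower F A n ∧ c * x ∈ lieSolvablePower F A n)
    (hLie : IsLieSolvable F A) (a b : A) : IsNilpotent (ρ (a * b) - ρ a * ρ b) :=
  hρ.isNilpotent_sub (n := 0) hF (fun _ _ _ => trivial)
    (hρ.isNilpotent_of_mem_one hF hideal hLie) trivial b

theorem isUnit_one_sub (hS : ∀ a b : A, IsNilpotent (ρ (a * b) - ρ a * ρ b)) {x y : A}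
    (h : IsUnit (1 - ρ (x + y - y * x))) : IsUnit (1 - ρ x) := by
  have hmul : (1 - ρ y) * (1 - ρ x) =
      -(ρ (y * x) - ρ y * ρ x) + (1 - ρ (x + y - y * x)) := by
    rw [map_sub, map_add]; ring
  have hu : IsUnit ((1 - ρ y) * (1 - ρ x)) := by
    rw [hmul]
    exact (hS y x).neg.isUnit_add_right_of_commute h (Commute.all _ _)
  exact isUnit_of_mul_isUnit_right hu

end IsRightMultiplicationMap

end RightMultiplications

/-! ### Quasiregularity and extensions -/

section Quasiregular

variable {F : Type*} {A : Type u} [Field F] [NonUnitalNonAssocRing A] [Module F A] [IsScalarTower F A A]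
  [SMulCommClass F A A]

open scoped IsMulCommutative in
theorem IsNovikov.exists_isRightMultiplicationMap (hA : IsNovikov A) :
    ∃ (T : Type u) (_ : CommRing T) (_ : Algebra F T) (ρ : A →ₗ[F] T)
      (φ : T →ₐ[F] Module.End F A), IsRightMultiplicationMap ρ ∧ ∀ a x, φ (ρ a) x = x * a := by
  let R : A →ₗ[F] Module.End F A := (LinearMap.mul F A).flip
  let L : A →ₗ[F] Module.End F A := LinearMap.mul F A
  have hR : ∀ a x, R a x = x * a := fun _ _ => rfl
  have hL : ∀ a x, L a x = a * x := fun _ _ => rfl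
  have hcomm : ∀ a b, R a * R b = R b * R a := fun a b =>
    LinearMap.ext fun x => hA.right_comm x b a
  have hLR : ∀ l c, L l * R c - R c * L l = R (l * c) - R l * R c := by
    intro l c
    ext x
    have h := hA.mul_mul_sub l x c
    simp only [LinearMap.sub_apply, Module.End.mul_apply, hR, hL]
    rw [hA.right_comm x c l, ← neg_sub, h, neg_sub]
  have hmul : ∀ a b c, R ((a * b) * c) - R (a * b) * R c = R b * (R (a * c) - R a * R c) := by
    intro a b c
    ext x
    have h := hA.associator_mul x a b c
    simp only [LinearMap.sub_apply, Module.End.mul_apply, hR]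
    rw [hA.right_comm x c (a * b), hA.right_comm x c a, ← neg_sub, h, ← neg_mul, neg_sub]
  have : IsMulCommutative (Algebra.adjoin F (Set.range R)) := Algebra.isMulCommutative_adjoin F (by
    rintro _ ⟨a, rfl⟩ _ ⟨b, rfl⟩
    exact hcomm a b)
  refine ⟨Algebra.adjoin F (Set.range R), inferInstance, inferInstance,
    R.codRestrict (Subalgebra.toSubmodule (Algebra.adjoin F (Set.range R)))
      (fun a => Algebra.subset_adjoin ⟨a, rfl⟩),
    (Algebra.adjoin F (Set.range R)).val, ⟨?_, ?_⟩, fun _ _ => rfl⟩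
  · intro a b c
    exact Subtype.ext (hmul a b c)
  · intro l k b a
    refine Subtype.ext ?_
    change (R (l * ((k * b) * a)) - R l * R ((k * b) * a))
        - (R (l * (k * b)) - R l * R (k * b)) * R a - R (k * b) * (R (l * a) - R l * R a) =
      (R (l * b) - R l * R b) * (R (k * a) - R k * R a) +
        R b * ((R (l * (k * a)) - R l * R (k * a)) - (R (l * k) - R l * R k) * R a
          - R k * (R (l * a) - R l * R a))
    rw [← hLR l ((k * b) * a), ← hLR l (k * b), ← hLR l a, ← hLR l b, ← hLR l (k * a), ← hLR l k]
    -- Commute `L l` with both sides of this identity.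
    have h := hmul k b a
    calc _ = L l * (R ((k * b) * a) - R (k * b) * R a)
          - (R ((k * b) * a) - R (k * b) * R a) * L l := by noncomm_ring
      _ = _ := by rw [h]; noncomm_ring

/-- The left-quasiregular Lie-solvable Novikov algebras are closed under extensions. -/
theorem isLeftQuasiregular_of_ideal_of_quotient (hF : (2 : F) ≠ 0) (hA : IsNovikov A)
    (hLie : IsLieSolvable F A) (I : AlgIdeal F A) (hI : IsLeftQuasiregular I)
    (hQ : IsLeftQuasiregular I.QuotAlg) : IsLeftQuasiregular A := by
  obtain ⟨T, _, _, ρ, φ, hρ, hφ⟩ := hA.exists_isRightMultiplicationMap (F := F)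
  have hS := hρ.isNilpotent_map_mul_sub hF (lieSolvablePower_mul_mem hF hA) hLie
  have hunitI : ∀ z ∈ I, IsUnit (1 - ρ z) := by
    intro z hz
    obtain ⟨w, hw⟩ := hI ⟨z, hz⟩
    refine IsRightMultiplicationMap.isUnit_one_sub hS (y := (w : A)) ?_
    have hw' : z + (w : A) - w * z = 0 := sub_eq_zero.2 (congrArg Subtype.val hw)
    rw [hw', map_zero, sub_zero]
    exact isUnit_one
  intro x
  obtain ⟨y', hy⟩ := hQ (I.proj x)
  obtain ⟨y, rfl⟩ := I.proj_surjective y'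
  rw [← map_add, ← I.proj_mul, I.proj_eq_proj] at hy
  have hu := IsRightMultiplicationMap.isUnit_one_sub hS (hunitI _ hy)
  obtain ⟨S, hSx⟩ := hu.exists_right_inv
  -- `x + y = y * x` means `(1 - R x) y = -x`.
  refine ⟨φ S (-x), ?_⟩
  have h := congrArg (fun f => φ f (-x)) hSx
  simp only [map_mul, map_sub, map_one, Module.End.mul_apply, LinearMap.sub_apply,
    Module.End.one_apply, hφ] at h
  rw [sub_eq_iff_eq_add, ← sub_eq_iff_eq_add'] at h
  rw [← h]
  abel

end Quasiregular

/-! ### Idempotent hearts in commutative ideals -/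

section Heart

variable {F A : Type*} [Field F] [NonUnitalNonAssocRing A] [Module F A]

theorem heart_le {M : Submodule F A} (hM : M ≠ ⊥)
    (hideal : ∀ x ∈ M, ∀ a : A, x * a ∈ M ∧ a * x ∈ M) : heart F A ≤ M :=
  sInf_le ⟨⟨M, fun a x hx => (hideal x hx a).2, fun x a hx => (hideal x hx a).1⟩, rfl, hM⟩

theorem heart_mul_mem {x : A} (hx : x ∈ heart F A) (a : A) :
    x * a ∈ heart F A ∧ a * x ∈ heart F A := by
  simp only [heart, Submodule.mem_sInf] at hx ⊢
  constructor
  · rintro _ ⟨I, rfl, hI⟩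
    exact I.mul_mem_right' x a (hx _ ⟨I, rfl, hI⟩)
  · rintro _ ⟨I, rfl, hI⟩
    exact I.mul_mem_left' a x (hx _ ⟨I, rfl, hI⟩)

variable [IsScalarTower F A A]

/-- The annihilator `N` of the heart within it is an ideal; were it nonzero, it would contain the
heart, whose square would vanish. -/
theorem eq_zero_of_mul_heart (hA : IsNovikov A) (h0 : heart F A ≠ ⊥)
    (hH : HasIdempotentHeart F A)
    (hcomm : ∀ x ∈ heart F A, ∀ y ∈ heart F A, x * y = y * x) {x : A} (hx : x ∈ heart F A)
    (hxH : ∀ y ∈ heart F A, x * y = 0) : x = 0 := by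
  let N : Submodule F A :=
    { carrier := {x | x ∈ heart F A ∧ ∀ y ∈ heart F A, x * y = 0}
      add_mem' := fun ha hb =>
        ⟨add_mem ha.1 hb.1, fun y hy => by rw [add_mul, ha.2 y hy, hb.2 y hy, add_zero]⟩
      zero_mem' := ⟨zero_mem _, fun y _ => zero_mul y⟩
      smul_mem' := fun r _ ha =>
        ⟨Submodule.smul_mem _ r ha.1, fun y hy => by rw [smul_mul_assoc, ha.2 y hy, smul_zero]⟩ }
  by_contra hne
  have hN : heart F A ≤ N := by
    refine heart_le (fun h => hne ((Submodule.mem_bot F).1 (h ▸ (⟨hx, hxH⟩ : x ∈ N)))) ?_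
    intro n hn a
    refine ⟨⟨(heart_mul_mem hn.1 a).1, fun y hy => ?_⟩, (heart_mul_mem hn.1 a).2, fun y hy => ?_⟩
    · rw [hA.right_comm, hn.2 y hy, zero_mul]
    · rw [hA.right_comm, hcomm _ (heart_mul_mem hy a).2 _ hn.1, hn.2 _ (heart_mul_mem hy a).2]
  refine h0 (le_bot_iff.1 ?_)
  rw [← hH, Submodule.span_le]
  rintro _ ⟨a, ha, b, hb, rfl⟩
  exact (hN ha).2 b hb

variable [SMulCommClass F A A]

/-- If the heart lies in a commutative ideal, then it is central; quasiregularity of a local unit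
of the heart is then contradictory. -/
theorem not_isLeftQuasiregular_of_heart_le (hA : IsNovikov A) (h0 : heart F A ≠ ⊥)
    (hH : HasIdempotentHeart F A) {K : Submodule F A} (hHK : heart F A ≤ K)
    (hK : ∀ x ∈ K, ∀ a : A, x * a ∈ K ∧ a * x ∈ K)
    (hcomm : ∀ x ∈ K, ∀ y ∈ K, x * y = y * x) : ¬ IsLeftQuasiregular A := by
  intro hA'
  have hAnn : ∀ x ∈ heart F A, (∀ y ∈ heart F A, x * y = 0) → x = 0 := fun x hx hxH =>
    eq_zero_of_mul_heart hA h0 hH (fun a ha b hb => hcomm a (hHK ha) b (hHK hb)) hx hxH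
  have hassocK : ∀ h ∈ K, ∀ l ∈ K, ∀ c : A, (h * l) * c = h * (l * c) := by
    intro h hh l hl c
    rw [hcomm h hh (l * c) (hK l hl c).1, hcomm h hh l hl, hA.right_comm]
  have hassoc : ∀ h ∈ heart F A, ∀ b c : A, (h * b) * c = h * (b * c) := by
    intro h hh b c
    refine sub_eq_zero.1 (hAnn _ (sub_mem (heart_mul_mem (heart_mul_mem hh b).1 c).1
      (heart_mul_mem hh _).1) fun x hx => ?_)
    -- The associator of `h, b, c` times `x` is that of `h, b * x, c`, and `b * x` lies in `K`.
    rw [← hA.associator_mul, hassocK h (hHK hh) _ (hK x (hHK hx) b).2, sub_self]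
  have hcentral : ∀ h ∈ heart F A, ∀ b : A, b * h = h * b := by
    intro h hh b
    refine sub_eq_zero.1 (hAnn _ (sub_mem (heart_mul_mem hh b).2 (heart_mul_mem hh b).1)
      fun x hx => ?_)
    rw [sub_mul, sub_eq_zero, hcomm _ (hK h (hHK hh) b).2 x (hHK hx), ← hassoc x hx,
      hA.right_comm, hcomm x (hHK hx) h (hHK hh), hA.right_comm]
  obtain ⟨h, hh, hne⟩ := Submodule.exists_mem_ne_zero_of_ne_bot h0
  -- The multiples of `h` by the heart form a nonzero ideal, so `h` itself is one of them.
  have hle : heart F A ≤ (heart F A).map (LinearMap.mulLeft F h) := by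
    refine heart_le (fun hbot => hne (hAnn h hh fun y hy => ?_)) ?_
    · exact (Submodule.mem_bot F).1 (hbot ▸ Submodule.mem_map_of_mem hy)
    · rintro _ ⟨x, hx, rfl⟩ a
      have hmem : (h * x) * a ∈ (heart F A).map (LinearMap.mulLeft F h) :=
        ⟨x * a, (heart_mul_mem hx a).1, (hassoc h hh x a).symm⟩
      refine ⟨hmem, ?_⟩
      rw [LinearMap.mulLeft_apply, hcentral _ (heart_mul_mem hh x).1 a]
      exact hmem
  obtain ⟨e, he, hhe⟩ := hle hh
  rw [LinearMap.mulLeft_apply] at hhe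
  obtain ⟨y, hy⟩ := hA' e
  have h1 : h + h * y = h * y := by
    calc h + h * y = h * (e + y) := by rw [mul_add, hhe]
      _ = (h * e) * y := by rw [hy, ← hassoc h hh, hA.right_comm]
      _ = h * y := by rw [hhe]
  exact hne (add_eq_right.1 h1)

theorem not_isNovikovSIWithIdempotentHeart (hF : (2 : F) ≠ 0) (hLie : IsLieSolvable F A)
    (hA' : IsLeftQuasiregular A) : ¬ IsNovikovSIWithIdempotentHeart F A := by
  rintro ⟨hA, h0, hH⟩
  have hLie' : ∃ n : ℕ, lieSolvablePower F A (n + 1) = ⊥ ∧ lieSolvablePower F A n ≠ ⊥ := by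
    by_contra! hcon
    obtain ⟨n, hn⟩ := hLie
    induction n with
    | zero => exact h0 (le_bot_iff.1 (hn ▸ le_top))
    | succ n ih => exact ih (hcon n hn)
  obtain ⟨n, hn, hn'⟩ := hLie'
  have hideal := lieSolvablePower_mul_mem hF hA n
  refine not_isLeftQuasiregular_of_heart_le hA h0 hH (heart_le hn' hideal) hideal ?_ hA'
  intro x hx y hy
  have h := commutator_mem_lieSolvablePower_succ hx hy
  rw [hn, Submodule.mem_bot] at h
  exact sub_eq_zero.1 h

end Heart

/-! ### Homomorphic images and the radical -/

section Image

variable {F A B : Type*} [Field F] [NonUnitalNonAssocRing A] [Module F A]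
  [NonUnitalNonAssocRing B] [Module F B]

theorem IsLieSolvable.of_surjective (hLie : IsLieSolvable F A) (f : A →ₙₐ[F] B)
    (hf : Function.Surjective f) : IsLieSolvable F B := by
  have hle : ∀ n, ∀ y ∈ lieSolvablePower F B n, ∃ x ∈ lieSolvablePower F A n, f x = y := by
    intro n
    induction n with
    | zero => exact fun y _ => (hf y).imp fun x hx => ⟨trivial, hx⟩
    | succ n ih =>
      intro y hy
      refine Submodule.span_induction
        (p := fun y _ => ∃ x ∈ lieSolvablePower F A (n + 1), f x = y) ?_ ?_ ?_ ?_ hy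
      · rintro _ ⟨u', hu', v', hv', rfl⟩
        obtain ⟨u, hu, rfl⟩ := ih u' hu'
        obtain ⟨v, hv, rfl⟩ := ih v' hv'
        exact ⟨_, commutator_mem_lieSolvablePower_succ hu hv, by simp⟩
      · exact ⟨0, zero_mem _, map_zero f⟩
      · rintro _ _ _ _ ⟨u, hu, rfl⟩ ⟨v, hv, rfl⟩
        exact ⟨u + v, add_mem hu hv, map_add f u v⟩
      · rintro r _ _ ⟨u, hu, rfl⟩
        exact ⟨r • u, Submodule.smul_mem _ r hu, map_smul f r u⟩
  obtain ⟨n, hn⟩ := hLie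
  refine ⟨n, (Submodule.eq_bot_iff _).2 fun y hy => ?_⟩
  obtain ⟨x, hx, rfl⟩ := hle n y hy
  rw [hn, Submodule.mem_bot] at hx
  rw [hx, map_zero]

theorem IsLeftQuasiregular.of_surjective (hA : IsLeftQuasiregular A) (f : A →ₙₐ[F] B)
    (hf : Function.Surjective f) : IsLeftQuasiregular B := by
  intro x
  obtain ⟨x, rfl⟩ := hf x
  obtain ⟨y, hy⟩ := hA x
  exact ⟨f y, by rw [← map_add, hy, map_mul]⟩

end Image

section Radical

variable {F : Type*} {A : Type u} [Field F] [NonUnitalNonAssocRing A] [Module F A]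

theorem IsAndrunakievich.of_isLieSolvable (hF : (2 : F) ≠ 0) (hA : IsNovikov A)
    (hLie : IsLieSolvable F A) (hA' : IsLeftQuasiregular A) : IsAndrunakievich F A :=
  ⟨hA, fun _ _ _ _ _ f hf => not_isNovikovSIWithIdempotentHeart hF (hLie.of_surjective f hf)
    (hA'.of_surjective f hf)⟩

end Radical

theorem lemma5 {F : Type*} [Field F] (hF : ringChar F ≠ 2)
    {A : Type*} [NonUnitalNonAssocRing A] [Module F A] [IsScalarTower F A A] [SMulCommClass F A A]
    (hA : IsNovikov A) (hLie : IsLieSolvable F A)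
    (I : AlgIdeal F A) (hI : IsLeftQuasiregular I) (hQ : IsLeftQuasiregular I.QuotAlg) :
    IsLeftQuasiregular A ∧ IsAndrunakievichRadical (⊤ : AlgIdeal F A) := by
  have hF' : (2 : F) ≠ 0 := Ring.two_ne_zero hF
  have hA' := isLeftQuasiregular_of_ideal_of_quotient hF' hA hLie I hI hQ
  refine ⟨hA', ?_, fun _ _ _ _ => trivial⟩
  let f : A →ₙₐ[F] (⊤ : AlgIdeal F A) :=
    { toFun := fun a => ⟨a, trivial⟩
      map_smul' := fun _ _ => rfl
      map_zero' := rfl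
      map_add' := fun _ _ => rfl
      map_mul' := fun _ _ => rfl }
  have hf : Function.Surjective f := fun x => ⟨x, rfl⟩
  exact .of_isLieSolvable hF'
    ⟨fun x y z => Subtype.ext (hA.associator_symm x y z),
      fun x y z => Subtype.ext (hA.right_comm x y z)⟩
    (hLie.of_surjective f hf) (hA'.of_surjective f hf)
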